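/- Let $0\le\beta<1$, and let $L^2(0,1)$ consist of real- or complex-valued functions. Let $T_\beta=(-i\partial_x)^3$ with domain $$\mathcal D_\beta=\{v\in H^3(0,1):\ v(0)=v(1)=0,\ v_x(1)=\beta v_x(0)\}.$$ Let $u_0\in L^2(0,1)$ and let $u\in C([0,\infty);L^2(0,1))$ be the (mild) solution of $u_t=iT_\beta u$ (that is, $u_t+u_{xxx}=0$ with $u(0,t)=u(1,t)=0$, $u_x(1,t)=\beta u_x(0,t)$) with $u(\cdot,0)=u_0$; this means that for every $t\ge 0$ one has $\int_0^t u(\cdot,s)\,ds\in\mathcal D_\beta$ and $u(\cdot,t)-u_0=iT_\beta\int_0^t u(\cdot,s)\,ds$. Then: 1. $\displaystyle \|u(\cdot,t)\|_{L^2(0,1)}^2\le\|u_0\|_{L^2(0,1)}^2$ for all $t\ge 0$. 2. The boundary trace $u_x(0,\cdot)$ exists in $L^2(0,t)$ for all $t\ge0$, and $$\int_0^t|u_x(0,s)|^2\,ds\le\frac1{1-\beta}\|u_0\|_{L^2(0,1)}^2 .$$ Here $u_x(0,\cdot)$ is the a.e. unique locally integrable function $g$ on $[0,\infty)$ such that,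 for all $t\ge0$, the $x$-derivative of $\int_0^t u(\cdot,s)\,ds$ at $x=0$ is $\int_0^t g(s)\,ds$. 3. For almost every $s>0$ the function $u(\cdot,s)$ has a weak derivative $u_x(\cdot,s)\in L^2(0,1)$, $u_x\in L^2(0,t;L^2(0,1))$ for all $t\ge0$, and $$\int_0^1 x|u(x,t)|^2\,dx+3\int_0^t\int_0^1|u_x(x,s)|^2\,dx\,ds\le\frac1{1-\beta}\|u_0\|_{L^2(0,1)}^2 .$$ 4. $\displaystyle \lim_{t\to\infty}\|u(\cdot,t)\|_{L^2(0,1)}^2=0$. -/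

import Mathlib

open Set Filter Topology MeasureTheory
open scoped ContDiff

noncomputable section

namespace AiryDirichlet

/-- The space `L²(0,1)` of (classes of) `𝕜`-valued functions, `𝕜 = ℝ` or `ℂ`. -/
abbrev L2I (𝕜 : Type*) [RCLike 𝕜] : Type _ :=
  Lp 𝕜 2 ((volume : Measure ℝ).restrict (Ioo (0 : ℝ) 1))

/-- `g` is the weak derivative of `f` on `(0,1)`: `∫ φ' f = - ∫ φ g` for every
test function `φ ∈ C_c^∞(0,1)`. -/
def HasWeakDeriv {𝕜 : Type*} [RCLike 𝕜] (f g : L2I 𝕜) : Prop :=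
  ∀ φ : ℝ → ℝ, ContDiff ℝ ∞ φ → HasCompactSupport φ → tsupport φ ⊆ Ioo (0 : ℝ) 1 →
    ∫ x in Ioo (0 : ℝ) 1, deriv φ x • f x = - ∫ x in Ioo (0 : ℝ) 1, φ x • g x

/-- The class `f` has a representative that is continuous on `[0,1]`, and the value of this
(unique) representative at the point `a ∈ [0,1]` is `c`. -/
def HasTrace {𝕜 : Type*} [RCLike 𝕜] (f : L2I 𝕜) (a : ℝ) (c : 𝕜) : Prop :=
  ∃ F : ℝ → 𝕜, ContinuousOn F (Icc 0 1) ∧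
    (∀ᵐ x ∂((volume : Measure ℝ).restrict (Ioo (0 : ℝ) 1)), f x = F x) ∧ F a = c

/-- `c = v_x(a)`: the weak derivative of `v` has the boundary value `c` at `a`. -/
def HasDerivTrace {𝕜 : Type*} [RCLike 𝕜] (v : L2I 𝕜) (a : ℝ) (c : 𝕜) : Prop :=
  ∃ v₁ : L2I 𝕜, HasWeakDeriv v v₁ ∧ HasTrace v₁ a c

/-- The graph of the operator `i T_β = i (-i ∂ₓ)³ = -∂ₓ³` with the domain
`{v ∈ H³(0,1) : v(0) = v(1) = 0, v_x(1) = β v_x(0)}`: `v` lies in this domain and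
`w = -v_xxx`. -/
def AiryGraph {𝕜 : Type*} [RCLike 𝕜] (β : ℝ) (v w : L2I 𝕜) : Prop :=
  (∃ v₁ v₂ v₃ : L2I 𝕜,
    HasWeakDeriv v v₁ ∧ HasWeakDeriv v₁ v₂ ∧ HasWeakDeriv v₂ v₃ ∧ w = -v₃) ∧
  HasTrace v 0 0 ∧ HasTrace v 1 0 ∧
  ∃ c : 𝕜, HasDerivTrace v 0 c ∧ HasDerivTrace v 1 ((β : 𝕜) * c)

/-- `u : [0,∞) → L²(0,1)` is the (mild) solution of `u_t = i T_β u`, `u(0) = u₀`: it is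
continuous, `∫₀ᵗ u(s) ds` lies in the domain of `T_β`, and
`u(t) - u₀ = i T_β ∫₀ᵗ u(s) ds` for all `t ≥ 0`.
The values of `u` at negative times play no role. -/
structure IsMildSolution {𝕜 : Type*} [RCLike 𝕜] (β : ℝ) (u₀ : L2I 𝕜) (u : ℝ → L2I 𝕜) :
    Prop where
  continuousOn : ContinuousOn u (Ici 0)
  initial : u 0 = u₀
  equation : ∀ t : ℝ, 0 ≤ t → AiryGraph β (∫ s in (0 : ℝ)..t, u s) (u t - u₀)

/-- `g = u_x(0,·)`, the boundary trace, locally integrable in time, of the `x`-derivative of `u`: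
`∫₀ᵗ g(s) ds` is the `x`-derivative at `x = 0` of `∫₀ᵗ u(·,s) ds`, for all `t ≥ 0`.
This determines `g` almost everywhere on `(0,∞)`. -/
def IsDerivTraceAtZero {𝕜 : Type*} [RCLike 𝕜] (u : ℝ → L2I 𝕜) (g : ℝ → 𝕜) : Prop :=
  ∀ t : ℝ, 0 ≤ t → IntervalIntegrable g volume 0 t ∧
    HasDerivTrace (∫ s in (0 : ℝ)..t, u s) 0 (∫ s in (0 : ℝ)..t, g s)

/-- `ux = u_x`: for almost every time `s > 0`, `ux s` is the weak derivative of `u s`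
(in particular, `u s ∈ H¹(0,1)`). This determines `ux` almost everywhere on `(0,∞)`. -/
def IsSpatialDeriv {𝕜 : Type*} [RCLike 𝕜] (u ux : ℝ → L2I 𝕜) : Prop :=
  ∀ᵐ s ∂((volume : Measure ℝ).restrict (Ioi 0)), HasWeakDeriv (u s) (ux s)

end AiryDirichlet

end

open AiryDirichlet

/-! For a smooth solution two multipliers suffice. Testing the equation with the conjugate of `u`
gives d/dt ‖u‖² = -(1-β²)|u_x(0)|²; testing with x times it gives d/dt ∫x|u|² + 3‖u_x‖² =
β²|u_x(0)|². Together they bound the norm, the boundary trace and the gradient by `1 / (1 - β ^ 2)`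
times ‖u₀‖². Decay follows from Poincaré: ‖u‖² is nonincreasing and integrable in time, so t‖u(t)‖²
stays bounded.

A mild solution need not be differentiable, so it is regularised in time. With V(t) = ∫₀ᵗ u, the
quotient (V(t+h) - V(t))/h lies in the domain and is a C¹ solution (`isClassicalSolution_diffQuot`),
and it tends to u(t) as h → 0. By linearity the estimates also hold for the difference of two
quotients, so traces and gradients are Cauchy in L²(0,∞); `exists_l2_limit_diffQuot` identifies
their limits. No semigroup theory is needed. The spatial integrations by parts rest on the product
rule `IsPrimitive.mul` and on `HasWeakDeriv.exists_primitive`. -/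

noncomputable section

namespace AiryDirichlet

/-! ### Absolutely continuous functions on [0,1] and their product rule -/

section Primitive

variable {𝕜 : Type*} [RCLike 𝕜]

/-- `F` is a primitive on `[0,1]` of the integrable function `f`. -/
structure IsPrimitive (f F : ℝ → 𝕜) : Prop where
  integrable : IntervalIntegrable f volume 0 1
  eq_add : ∀ x ∈ Icc (0 : ℝ) 1, F x = F 0 + ∫ y in (0 : ℝ)..x, f y

/-- Increments of the integral of `f` are dominated by those of the integral of ‖f‖, which reduces
the claim to the real-valued case. -/
theorem absolutelyContinuousOnInterval_integral {f : ℝ → 𝕜}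
    (hf : IntervalIntegrable f volume 0 1) :
    AbsolutelyContinuousOnInterval (fun x => ∫ y in (0 : ℝ)..x, f y) 0 1 := by
  have key := hf.norm.absolutelyContinuousOnInterval_intervalIntegral (c := 0) (by simp)
  unfold AbsolutelyContinuousOnInterval at key ⊢
  refine squeeze_zero' (Eventually.of_forall fun _ => Finset.sum_nonneg fun _ _ => dist_nonneg)
    ?_ key
  rw [eventually_inf_principal]
  refine Eventually.of_forall fun ⟨n, I⟩ hI => ?_
  refine Finset.sum_le_sum fun i hi => ?_
  have hi1 := (hI.1 i hi).1
  have hi2 := (hI.1 i hi).2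
  have h0 : (0 : ℝ) ∈ uIcc (0 : ℝ) 1 := by simp
  have s : ∀ {x y : ℝ}, x ∈ uIcc (0 : ℝ) 1 → y ∈ uIcc (0 : ℝ) 1 →
      IntervalIntegrable f volume x y := fun hx hy =>
    hf.mono_set (uIcc_subset_uIcc hx hy)
  rw [dist_comm, dist_comm (∫ y in (0 : ℝ)..(I i).1, ‖f y‖), dist_eq_norm, dist_eq_norm,
    intervalIntegral.integral_interval_sub_left (s h0 hi2) (s h0 hi1),
    intervalIntegral.integral_interval_sub_left (s h0 hi2).norm (s h0 hi1).norm]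
  exact intervalIntegral.norm_integral_le_abs_integral_norm

namespace IsPrimitive

variable {f g F G : ℝ → 𝕜}

theorem mono_integrable (h : IsPrimitive f F) {x : ℝ} (hx : x ∈ Icc (0 : ℝ) 1) :
    IntervalIntegrable f volume 0 x :=
  h.integrable.mono_set (uIcc_subset_uIcc (by simp) (by simpa using hx))

theorem continuousOn (h : IsPrimitive f F) : ContinuousOn F (Icc 0 1) := by
  have := (absolutelyContinuousOnInterval_integral h.integrable).continuousOn
  rw [uIcc_of_le zero_le_one] at this
  exact (continuousOn_const.add this).congr h.eq_add

theorem integral_eq (h : IsPrimitive f F) : ∫ y in (0 : ℝ)..1, f y = F 1 - F 0 := by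
  rw [h.eq_add 1 (by simp)]; ring

theorem add (hf : IsPrimitive f F) (hg : IsPrimitive g G) :
    IsPrimitive (fun x => f x + g x) (fun x => F x + G x) where
  integrable := hf.integrable.add hg.integrable
  eq_add x hx := by
    rw [intervalIntegral.integral_add (hf.mono_integrable hx) (hg.mono_integrable hx),
      hf.eq_add x hx, hg.eq_add x hx]
    ring

theorem sub (hf : IsPrimitive f F) (hg : IsPrimitive g G) :
    IsPrimitive (fun x => f x - g x) (fun x => F x - G x) where
  integrable := hf.integrable.sub hg.integrable
  eq_add x hx := by
    rw [intervalIntegral.integral_sub (hf.mono_integrable hx) (hg.mono_integrable hx),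
      hf.eq_add x hx, hg.eq_add x hx]
    ring

theorem conj (hf : IsPrimitive f F) :
    IsPrimitive (fun x => starRingEnd 𝕜 (f x)) (fun x => starRingEnd 𝕜 (F x)) where
  integrable := by
    have h := hf.integrable
    rw [intervalIntegrable_iff] at h ⊢
    exact (RCLike.conjCLE (K := 𝕜)).toContinuousLinearMap.integrable_comp h
  eq_add x hx := by
    rw [hf.eq_add x hx, map_add]
    congr 1
    exact ((RCLike.conjCLE (K := 𝕜)).toContinuousLinearMap.intervalIntegral_comp_comm
      (hf.mono_integrable hx)).symm

/-- The product minus the integral of its formal derivative is absolutely continuous with derivative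
zero almost everywhere, hence constant. -/
theorem mul (hf : IsPrimitive f F) (hg : IsPrimitive g G) :
    IsPrimitive (fun x => f x * G x + F x * g x) (fun x => F x * G x) := by
  have hc : uIcc (0 : ℝ) 1 = Icc 0 1 := uIcc_of_le zero_le_one
  have hF := hf.continuousOn
  have hG := hg.continuousOn
  have hint : IntervalIntegrable (fun x => f x * G x + F x * g x) volume 0 1 :=
    (hf.integrable.mul_continuousOn (hc ▸ hG)).add (hg.integrable.continuousOn_mul (hc ▸ hF))
  refine ⟨hint, fun x hx => ?_⟩
  let F' : ℝ → 𝕜 := fun x => ∫ y in (0 : ℝ)..x, f y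
  let G' : ℝ → 𝕜 := fun x => ∫ y in (0 : ℝ)..x, g y
  have acc : ∀ c : 𝕜, AbsolutelyContinuousOnInterval (fun _ : ℝ => c) 0 1 := fun c =>
    contDiffOn_const.absolutelyContinuousOnInterval
  have acF : AbsolutelyContinuousOnInterval ((fun _ => F 0) + F') 0 1 :=
    (acc _).add (absolutelyContinuousOnInterval_integral hf.integrable)
  have acG : AbsolutelyContinuousOnInterval ((fun _ => G 0) + G') 0 1 :=
    (acc _).add (absolutelyContinuousOnInterval_integral hg.integrable)
  have acH := (acF.smul acG).sub (absolutelyContinuousOnInterval_integral hint)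
  obtain ⟨C, hC⟩ := acH.const_of_ae_hasDerivAt_zero (by
    filter_upwards [hf.integrable.ae_hasDerivAt_integral, hg.integrable.ae_hasDerivAt_integral,
      hint.ae_hasDerivAt_integral] with x h1 h2 h3 hx
    have h1 := (h1 hx 0 (by simp)).const_add (F 0)
    have h2 := (h2 hx 0 (by simp)).const_add (G 0)
    have h3 := h3 hx 0 (by simp)
    have h4 := (h1.mul h2).sub h3
    rw [hc] at hx
    rw [← hf.eq_add x hx, ← hg.eq_add x hx, sub_self] at h4
    exact h4)
  have e1 := hC x (hc ▸ hx)
  have e0 := hC 0 (by simp)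
  simp only [Pi.sub_apply, Pi.mul_apply, Pi.add_apply, smul_eq_mul, F', G',
    intervalIntegral.integral_same, add_zero, sub_zero] at e1 e0
  rw [← hf.eq_add x hx, ← hg.eq_add x hx, ← e0] at e1
  exact sub_eq_iff_eq_add.mp e1

theorem of_hasDerivAt (h : ∀ x, HasDerivAt F (f x) x) (hf : Continuous f) : IsPrimitive f F where
  integrable := hf.intervalIntegrable _ _
  eq_add x _ := by
    rw [intervalIntegral.integral_eq_sub_of_hasDerivAt (fun y _ => h y)
      (hf.intervalIntegrable _ _)]
    ring

end IsPrimitive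

end Primitive

/-! ### Weak derivatives on (0,1) and their continuous representatives -/

section WeakDerivative

variable {𝕜 : Type*} [RCLike 𝕜]

theorem setIntegral_Ioo_eq (f : ℝ → 𝕜) :
    ∫ x in Ioo (0 : ℝ) 1, f x = ∫ x in (0 : ℝ)..1, f x := by
  rw [intervalIntegral.integral_of_le zero_le_one, integral_Ioc_eq_integral_Ioo]

theorem integrable_coe (f : L2I 𝕜) :
    Integrable f ((volume : Measure ℝ).restrict (Ioo (0 : ℝ) 1)) :=
  (Lp.memLp f).integrable one_le_two

theorem intervalIntegrable_iff_integrable_Ioo {f : ℝ → 𝕜} :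
    IntervalIntegrable f volume 0 1 ↔
      Integrable f ((volume : Measure ℝ).restrict (Ioo (0 : ℝ) 1)) :=
  intervalIntegrable_iff_integrableOn_Ioo_of_le zero_le_one

theorem isPrimitive_integral (g : L2I 𝕜) (c : 𝕜) :
    IsPrimitive g (fun x => c + ∫ y in (0 : ℝ)..x, g y) where
  integrable := intervalIntegrable_iff_integrable_Ioo.2 (integrable_coe g)
  eq_add x _ := by simp

theorem IsPrimitive.congr_ae {f f' F : ℝ → 𝕜} (h : IsPrimitive f F)
    (hf : ∀ᵐ x ∂((volume : Measure ℝ).restrict (Ioo (0 : ℝ) 1)), f x = f' x) :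
    IsPrimitive f' F := by
  have hf' : ∀ᵐ x ∂volume.restrict (uIoc (0 : ℝ) 1), f x = f' x := by
    rw [uIoc_of_le zero_le_one, Measure.restrict_congr_set Ioo_ae_eq_Ioc.symm]
    exact hf
  refine ⟨h.integrable.congr_ae hf', fun x hx => ?_⟩
  rw [h.eq_add x hx]
  congr 1
  refine intervalIntegral.integral_congr_ae_restrict ?_
  refine ae_mono (Measure.restrict_mono ?_ le_rfl) hf'
  rw [uIoc_of_le zero_le_one, uIoc_of_le hx.1]
  exact Ioc_subset_Ioc_right hx.2

theorem integral_deriv_smul_primitive {φ : ℝ → ℝ} (hφ : ContDiff ℝ ∞ φ)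
    (hs : tsupport φ ⊆ Ioo (0 : ℝ) 1) {g G : ℝ → 𝕜} (hG : IsPrimitive g G) :
    ∫ x in Ioo (0 : ℝ) 1, deriv φ x • G x = - ∫ x in Ioo (0 : ℝ) 1, φ x • g x := by
  have hd : Continuous (deriv φ) := hφ.continuous_deriv (by simp)
  have hp : IsPrimitive (fun x => ((deriv φ x : ℝ) : 𝕜)) (fun x => ((φ x : ℝ) : 𝕜)) :=
    .of_hasDerivAt (fun x => (RCLike.ofRealCLM (K := 𝕜)).hasFDerivAt.comp_hasDerivAt x
      ((hφ.differentiable (by simp)) x).hasDerivAt) (RCLike.continuous_ofReal.comp hd)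
  have h0 : φ 0 = 0 := image_eq_zero_of_notMem_tsupport fun h => by simpa using hs h
  have h1 : φ 1 = 0 := image_eq_zero_of_notMem_tsupport fun h => by simpa using hs h
  have key := (hp.mul hG).integral_eq
  have hc : uIcc (0 : ℝ) 1 = Icc 0 1 := uIcc_of_le zero_le_one
  rw [intervalIntegral.integral_add (hp.integrable.mul_continuousOn (hc ▸ hG.continuousOn))
    (hG.integrable.continuousOn_mul (hc ▸ hp.continuousOn))] at key
  simp only [h0, h1, RCLike.ofReal_zero, zero_mul, sub_zero] at key
  simp only [setIntegral_Ioo_eq, RCLike.real_smul_eq_coe_mul]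
  exact eq_neg_of_add_eq_zero_left key

theorem hasWeakDeriv_of_primitive {f g : L2I 𝕜} {F : ℝ → 𝕜}
    (hf : ∀ᵐ x ∂((volume : Measure ℝ).restrict (Ioo (0 : ℝ) 1)), f x = F x)
    (h : IsPrimitive g F) : HasWeakDeriv f g := by
  intro φ hφ _ hs
  rw [← integral_deriv_smul_primitive hφ hs h]
  exact integral_congr_ae (hf.mono fun x hx => by simp [hx])

theorem ae_eq_zero_of_integral_test {f : ℝ → 𝕜}
    (hf : Integrable f ((volume : Measure ℝ).restrict (Ioo (0 : ℝ) 1)))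
    (h : ∀ φ : ℝ → ℝ, ContDiff ℝ ∞ φ → HasCompactSupport φ → tsupport φ ⊆ Ioo (0 : ℝ) 1 →
      ∫ x in Ioo (0 : ℝ) 1, φ x • f x = 0) :
    ∀ᵐ x ∂((volume : Measure ℝ).restrict (Ioo (0 : ℝ) 1)), f x = 0 := by
  have := isOpen_Ioo.ae_eq_zero_of_integral_contDiff_smul_eq_zero
    (hf.locallyIntegrable.locallyIntegrableOn _) h
  filter_upwards [this, ae_restrict_mem measurableSet_Ioo] with x hx hx' using hx hx'

theorem integrable_smul_test {φ : ℝ → ℝ} (hφ : Continuous φ) (hc : HasCompactSupport φ)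
    {f : ℝ → 𝕜} (hf : Integrable f ((volume : Measure ℝ).restrict (Ioo (0 : ℝ) 1))) :
    Integrable (fun x => φ x • f x) ((volume : Measure ℝ).restrict (Ioo (0 : ℝ) 1)) := by
  obtain ⟨C, hC⟩ := hc.exists_bound_of_continuous hφ
  exact hf.bdd_smul C hφ.aestronglyMeasurable (Eventually.of_forall hC)

theorem HasWeakDeriv.unique {f g g' : L2I 𝕜} (h : HasWeakDeriv f g) (h' : HasWeakDeriv f g') :
    g = g' := by
  refine Lp.ext ?_
  have := ae_eq_zero_of_integral_test ((integrable_coe g).sub (integrable_coe g'))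
    fun φ hφ hc hs => by
      simp only [Pi.sub_apply, smul_sub]
      rw [integral_sub (integrable_smul_test hφ.continuous hc (integrable_coe g))
        (integrable_smul_test hφ.continuous hc (integrable_coe g')), sub_eq_zero,
        ← neg_inj, ← h φ hφ hc hs, h' φ hφ hc hs]
  exact this.mono fun x hx => sub_eq_zero.1 hx

/-- A test function of integral zero is the derivative of a test function. -/
theorem exists_test_deriv_eq {ψ : ℝ → ℝ} (hψ : ContDiff ℝ ∞ ψ) (hc : HasCompactSupport ψ)
    (hs : tsupport ψ ⊆ Ioo (0 : ℝ) 1) (h0 : ∫ x in (0 : ℝ)..1, ψ x = 0) :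
    ∃ θ : ℝ → ℝ, ContDiff ℝ ∞ θ ∧ HasCompactSupport θ ∧ tsupport θ ⊆ Ioo (0 : ℝ) 1 ∧
      deriv θ = ψ := by
  set θ : ℝ → ℝ := fun x => ∫ y in (0 : ℝ)..x, ψ y with hθ
  have hd : ∀ x, HasDerivAt θ (ψ x) x := fun x =>
    hψ.continuous.integral_hasStrictDerivAt 0 x |>.hasDerivAt
  have hderiv : deriv θ = ψ := funext fun x => (hd x).deriv
  -- The point 1/2 keeps the compact set nonempty when `ψ = 0`, so that its infimum and supremum lie
  -- in (0,1).
  have hK : IsCompact (insert (1 / 2 : ℝ) (tsupport ψ)) := hc.isCompact.insert _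
  have hne : (insert (1 / 2 : ℝ) (tsupport ψ)).Nonempty := insert_nonempty _ _
  have hsub : insert (1 / 2 : ℝ) (tsupport ψ) ⊆ Ioo (0 : ℝ) 1 :=
    insert_subset (by norm_num) hs
  set a := sInf (insert (1 / 2 : ℝ) (tsupport ψ))
  set b := sSup (insert (1 / 2 : ℝ) (tsupport ψ))
  have ha := hsub (hK.sInf_mem hne)
  have hb := hsub (hK.sSup_mem hne)
  have hzero : ∀ x, x ∉ Icc a b → ψ x = 0 := fun x hx =>
    image_eq_zero_of_notMem_tsupport fun h =>
      hx ⟨csInf_le hK.bddBelow (mem_insert_of_mem _ h), le_csSup hK.bddAbove (mem_insert_of_mem _ h)⟩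
  have hsupp : Function.support θ ⊆ Icc a b := by
    intro x hx
    by_contra hcon
    refine hx ?_
    rcases not_and_or.1 hcon with h | h
    · push Not at h
      refine (intervalIntegral.integral_congr (g := fun _ => 0) fun y hy => hzero y fun hy' => ?_).trans
        (by simp)
      have := hy.2.trans_lt (max_lt ha.1 h)
      exact absurd hy'.1 (not_le.2 this)
    · push Not at h
      -- Right of the support, `θ` equals the total integral of `ψ`; this is where `h0` enters.
      have h1 : ∫ y in x..1, ψ y = 0 := by
        refine (intervalIntegral.integral_congr (g := fun _ => 0) fun y hy =>
          hzero y fun hy' => ?_).trans (by simp)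
        have := (lt_min h hb.2).trans_le hy.1
        exact absurd hy'.2 (not_le.2 this)
      have h2 := intervalIntegral.integral_add_adjacent_intervals
        (hψ.continuous.intervalIntegrable (μ := volume) 0 x) (hψ.continuous.intervalIntegrable x 1)
      rw [h1, h0, add_zero] at h2
      exact h2
  have hts : tsupport θ ⊆ Icc a b := closure_minimal hsupp isClosed_Icc
  refine ⟨θ, ?_, isCompact_Icc.of_isClosed_subset (isClosed_tsupport θ) hts,
    hts.trans (Icc_subset_Ioo ha.1 hb.2), hderiv⟩
  rw [contDiff_infty_iff_deriv]
  exact ⟨fun x => (hd x).differentiableAt, hderiv ▸ hψ⟩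

/-- The lemma of du Bois-Reymond on `(0,1)`. -/
theorem exists_ae_eq_const {f : ℝ → 𝕜}
    (hf : Integrable f ((volume : Measure ℝ).restrict (Ioo (0 : ℝ) 1)))
    (h : ∀ φ : ℝ → ℝ, ContDiff ℝ ∞ φ → HasCompactSupport φ → tsupport φ ⊆ Ioo (0 : ℝ) 1 →
      ∫ x in Ioo (0 : ℝ) 1, deriv φ x • f x = 0) :
    ∃ c : 𝕜, ∀ᵐ x ∂((volume : Measure ℝ).restrict (Ioo (0 : ℝ) 1)), f x = c := by
  let B : ContDiffBump (1 / 2 : ℝ) := ⟨1 / 8, 1 / 4, by norm_num, by norm_num⟩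
  set ρ : ℝ → ℝ := B.normed volume with hρ
  have hρd : ContDiff ℝ ∞ ρ := B.contDiff_normed
  have hρc : HasCompactSupport ρ := B.hasCompactSupport_normed
  have hρs : tsupport ρ ⊆ Ioo (0 : ℝ) 1 := by
    rw [hρ, B.tsupport_normed_eq, Real.closedBall_eq_Icc]
    exact Icc_subset_Ioo (by norm_num [B]) (by norm_num [B])
  have hρi : ∫ x in (0 : ℝ)..1, ρ x = 1 := by
    rw [intervalIntegral.integral_eq_integral_of_support_subset, B.integral_normed]
    exact (subset_tsupport ρ).trans (hρs.trans Ioo_subset_Ioc_self)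
  set c : 𝕜 := ∫ x in Ioo (0 : ℝ) 1, ρ x • f x with hcdef
  refine ⟨c, ?_⟩
  have := ae_eq_zero_of_integral_test (hf.sub (integrable_const c)) fun φ hφ hφc hφs => by
    -- Subtracting `m * ρ` makes the integral vanish, so `φ - m * ρ` is the derivative of a test
    -- function, and `h` then gives ∫ φ f = m c.
    set m := ∫ x in (0 : ℝ)..1, φ x with hm
    obtain ⟨θ, hθ, hθc, hθs, hθd⟩ := exists_test_deriv_eq (ψ := fun x => φ x - m * ρ x)
      (hφ.sub (contDiff_const.mul hρd)) (hφc.sub (hρc.mul_left (f := fun _ => m)))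
      ((tsupport_sub _ _).trans (union_subset hφs ((tsupport_mul_subset_right).trans hρs)))
      (by
        rw [intervalIntegral.integral_sub (hφ.continuous.intervalIntegrable _ _)
          (show IntervalIntegrable (fun x => m * ρ x) volume 0 1 from
            (hρd.continuous.const_mul m).intervalIntegrable _ _),
          intervalIntegral.integral_const_mul, hρi, hm]
        ring)
    have key := h θ hθ hθc hθs
    simp only [hθd, sub_smul, mul_smul] at key
    rw [integral_sub (integrable_smul_test hφ.continuous hφc hf)
      (show Integrable (fun x => m • ρ x • f x) _ from
        (integrable_smul_test hρd.continuous hρc hf).smul m), integral_smul, ← hcdef,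
      sub_eq_zero] at key
    simp only [Pi.sub_apply, smul_sub]
    rw [integral_sub (integrable_smul_test hφ.continuous hφc hf)
      (integrable_smul_test hφ.continuous hφc (integrable_const c)), key, integral_smul_const,
      hm, intervalIntegral.integral_of_le zero_le_one, integral_Ioc_eq_integral_Ioo, sub_self]
  exact this.mono fun x hx => sub_eq_zero.1 hx

/-- The difference of `f` and the integral of `g` has weak derivative zero, so du Bois-Reymond makes
it constant. -/
theorem HasWeakDeriv.exists_primitive {f g : L2I 𝕜} (h : HasWeakDeriv f g) :
    ∃ F : ℝ → 𝕜, IsPrimitive g F ∧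
      ∀ᵐ x ∂((volume : Measure ℝ).restrict (Ioo (0 : ℝ) 1)), f x = F x := by
  have hG := isPrimitive_integral g 0
  have hGi : Integrable (fun x => 0 + ∫ y in (0 : ℝ)..x, g y)
      ((volume : Measure ℝ).restrict (Ioo (0 : ℝ) 1)) :=
    intervalIntegrable_iff_integrable_Ioo.1
      ((uIcc_of_le (zero_le_one (α := ℝ)) ▸ hG.continuousOn :
        ContinuousOn _ (uIcc (0 : ℝ) 1)).intervalIntegrable)
  obtain ⟨c, hc⟩ := exists_ae_eq_const ((integrable_coe f).sub hGi) fun φ hφ hφc hφs => by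
    have hd : Continuous (deriv φ) := hφ.continuous_deriv (by simp)
    simp only [Pi.sub_apply, smul_sub]
    rw [integral_sub (integrable_smul_test hd hφc.deriv (integrable_coe f))
      (integrable_smul_test hd hφc.deriv hGi), h φ hφ hφc hφs,
      integral_deriv_smul_primitive hφ hφs hG, sub_self]
  refine ⟨_, isPrimitive_integral g c, hc.mono fun x hx => ?_⟩
  rw [Pi.sub_apply, sub_eq_iff_eq_add, zero_add] at hx
  exact hx

/-- Continuous functions that agree almost everywhere agree up to the endpoints, so a trace can be
read off any continuous representative. -/
theorem HasTrace.eq_of_continuousOn {f : L2I 𝕜} {a : ℝ} (ha : a ∈ Icc (0 : ℝ) 1) {c : 𝕜}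
    (h : HasTrace f a c) {F : ℝ → 𝕜} (hF : ContinuousOn F (Icc 0 1))
    (hf : ∀ᵐ x ∂((volume : Measure ℝ).restrict (Ioo (0 : ℝ) 1)), f x = F x) : F a = c := by
  obtain ⟨G, hG, hfG, rfl⟩ := h
  refine Measure.eqOn_Icc_of_ae_eq (μ := volume) zero_ne_one ?_ hF hG ha
  rw [Measure.restrict_congr_set Ioo_ae_eq_Icc.symm]
  filter_upwards [hf, hfG] with x h1 h2 using h1.symm.trans h2

end WeakDerivative

/-! ### Multiplier identities for elements of the domain -/

section Energy

variable {𝕜 : Type*} [RCLike 𝕜]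

/-- `AiryProfile β v w v₁ c`: `v` lies in the domain of `T_β`, `w = -v_xxx`, `v₁ = v_x`, and
`c = v_x(0)`, expressed through continuous representatives. -/
def AiryProfile (β : ℝ) (v w v₁ : L2I 𝕜) (c : 𝕜) : Prop :=
  ∃ F₀ F₁ F₂ : ℝ → 𝕜, IsPrimitive F₁ F₀ ∧ IsPrimitive F₂ F₁ ∧ IsPrimitive (fun x => -w x) F₂ ∧
    (∀ᵐ x ∂((volume : Measure ℝ).restrict (Ioo (0 : ℝ) 1)), v x = F₀ x) ∧
    (∀ᵐ x ∂((volume : Measure ℝ).restrict (Ioo (0 : ℝ) 1)), v₁ x = F₁ x) ∧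
    F₀ 0 = 0 ∧ F₀ 1 = 0 ∧ F₁ 0 = c ∧ F₁ 1 = β * c

theorem AiryGraph.exists_profile {β : ℝ} {v w : L2I 𝕜} (h : AiryGraph β v w) :
    ∃ v₁ c, AiryProfile β v w v₁ c := by
  obtain ⟨⟨v₁, v₂, v₃, h1, h2, h3, rfl⟩, t0, t1, c, ⟨a, ha, ta⟩, ⟨b, hb, tb⟩⟩ := h
  obtain rfl := h1.unique ha
  obtain rfl := h1.unique hb
  obtain ⟨F₀, p0, e0⟩ := h1.exists_primitive
  obtain ⟨F₁, p1, e1⟩ := h2.exists_primitive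
  obtain ⟨F₂, p2, e2⟩ := h3.exists_primitive
  refine ⟨v₁, c, F₀, F₁, F₂, p0.congr_ae e1, p1.congr_ae e2, p2.congr_ae ?_, e0, e1,
    t0.eq_of_continuousOn (by simp) p0.continuousOn e0,
    t1.eq_of_continuousOn (by simp) p0.continuousOn e0,
    ta.eq_of_continuousOn (by simp) p1.continuousOn e1,
    tb.eq_of_continuousOn (by simp) p1.continuousOn e1⟩
  exact (Lp.coeFn_neg v₃).mono fun x hx => by rw [hx, Pi.neg_apply, neg_neg]

theorem IsPrimitive.const_smul {f F : ℝ → 𝕜} (h : IsPrimitive f F) (r : ℝ) :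
    IsPrimitive (fun x => r • f x) (fun x => r • F x) where
  integrable := h.integrable.smul r
  eq_add x hx := by rw [intervalIntegral.integral_smul, ← smul_add, ← h.eq_add x hx]

namespace AiryProfile

variable {β : ℝ} {v w v₁ v' w' v₁' : L2I 𝕜} {c c' : 𝕜}

theorem hasWeakDeriv (h : AiryProfile β v w v₁ c) : HasWeakDeriv v v₁ := by
  obtain ⟨F₀, F₁, F₂, p0, p1, p2, e0, e1, -⟩ := h
  exact hasWeakDeriv_of_primitive e0 (p0.congr_ae (e1.mono fun x hx => hx.symm))

theorem hasDerivTrace (h : AiryProfile β v w v₁ c) : HasDerivTrace v 0 c := by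
  refine ⟨v₁, h.hasWeakDeriv, ?_⟩
  obtain ⟨F₀, F₁, F₂, p0, p1, p2, e0, e1, -, -, hc, -⟩ := h
  exact ⟨F₁, p1.continuousOn, e1, hc⟩

theorem sub (h : AiryProfile β v w v₁ c) (h' : AiryProfile β v' w' v₁' c') :
    AiryProfile β (v - v') (w - w') (v₁ - v₁') (c - c') := by
  obtain ⟨F₀, F₁, F₂, p0, p1, p2, e0, e1, a0, a1, b0, b1⟩ := h
  obtain ⟨G₀, G₁, G₂, q0, q1, q2, d0, d1, a0', a1', b0', b1'⟩ := h'
  refine ⟨_, _, _, p0.sub q0, p1.sub q1, (p2.sub q2).congr_ae ?_, ?_, ?_, ?_, ?_, ?_, ?_⟩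
  · filter_upwards [Lp.coeFn_sub w w'] with x hx
    rw [hx, Pi.sub_apply]; ring
  · filter_upwards [Lp.coeFn_sub v v', e0, d0] with x hx h1 h2
    rw [hx, Pi.sub_apply, h1, h2]
  · filter_upwards [Lp.coeFn_sub v₁ v₁', e1, d1] with x hx h1 h2
    rw [hx, Pi.sub_apply, h1, h2]
  · simp [a0, a0']
  · simp [a1, a1']
  · simp [b0, b0']
  · simp [b1, b1', mul_sub]

theorem const_smul (h : AiryProfile β v w v₁ c) (r : ℝ) :
    AiryProfile β (r • v) (r • w) (r • v₁) (r • c) := by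
  obtain ⟨F₀, F₁, F₂, p0, p1, p2, e0, e1, a0, a1, b0, b1⟩ := h
  refine ⟨_, _, _, p0.const_smul r, p1.const_smul r, (p2.const_smul r).congr_ae ?_, ?_, ?_, ?_,
    ?_, ?_, ?_⟩
  · filter_upwards [Lp.coeFn_smul r w] with x hx
    rw [hx, Pi.smul_apply, smul_neg]
  · filter_upwards [Lp.coeFn_smul r v, e0] with x hx h1
    rw [hx, Pi.smul_apply, h1]
  · filter_upwards [Lp.coeFn_smul r v₁, e1] with x hx h1
    rw [hx, Pi.smul_apply, h1]
  · simp [a0]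
  · simp [a1]
  · simp [b0]
  · simp [b1]

end AiryProfile

theorem memLp_coordinate : MemLp (fun x : ℝ => (x : 𝕜)) ⊤
    ((volume : Measure ℝ).restrict (Ioo (0 : ℝ) 1)) :=
  memLp_top_of_bound RCLike.continuous_ofReal.aestronglyMeasurable 1 <| by
    filter_upwards [ae_restrict_mem measurableSet_Ioo] with x hx
    rw [RCLike.norm_ofReal, abs_of_pos hx.1]
    exact hx.2.le

/-- Multiplication by the coordinate `x`. -/
def mulCoord : L2I 𝕜 →L[𝕜] L2I 𝕜 :=
  (ContinuousLinearMap.mul 𝕜 𝕜).holderL ((volume : Measure ℝ).restrict (Ioo (0 : ℝ) 1)) ⊤ 2 2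
    memLp_coordinate.toLp

theorem coeFn_mulCoord (f : L2I 𝕜) :
    ∀ᵐ x ∂((volume : Measure ℝ).restrict (Ioo (0 : ℝ) 1)), mulCoord f x = (x : 𝕜) * f x := by
  filter_upwards [(ContinuousLinearMap.mul 𝕜 𝕜).coeFn_holder (r := 2)
    (memLp_coordinate (𝕜 := 𝕜)).toLp f, (memLp_coordinate (𝕜 := 𝕜)).coeFn_toLp] with x h1 h2
  rw [h2] at h1
  exact h1

theorem inner_eq_integral (f g : L2I 𝕜) :
    inner 𝕜 f g = ∫ x in (0 : ℝ)..1, g x * starRingEnd 𝕜 (f x) := by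
  rw [L2.inner_def, ← setIntegral_Ioo_eq]
  simp only [RCLike.inner_apply]

theorem intervalIntegrable_mul_conj (f g : L2I 𝕜) :
    IntervalIntegrable (fun x => g x * starRingEnd 𝕜 (f x)) volume 0 1 := by
  rw [intervalIntegrable_iff_integrable_Ioo]
  simpa only [RCLike.inner_apply] using L2.integrable_inner (𝕜 := 𝕜) f g

theorem inner_mulCoord_left (f g : L2I 𝕜) :
    inner 𝕜 (mulCoord f) g = inner 𝕜 f (mulCoord g) := by
  rw [L2.inner_def, L2.inner_def]
  refine integral_congr_ae ?_
  filter_upwards [coeFn_mulCoord f, coeFn_mulCoord g] with x h1 h2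
  simp only [h1, h2, RCLike.inner_apply, map_mul, RCLike.conj_ofReal]
  ring

theorem re_inner_mulCoord_self (f : L2I 𝕜) :
    RCLike.re (inner 𝕜 (mulCoord f) f) = ∫ x in Ioo (0 : ℝ) 1, x * ‖f x‖ ^ 2 := by
  rw [L2.inner_def, ← RCLike.reCLM_apply, ← ContinuousLinearMap.integral_comp_comm]
  · refine integral_congr_ae ?_
    filter_upwards [coeFn_mulCoord f] with x hx
    rw [RCLike.reCLM_apply, hx, RCLike.inner_apply, map_mul (starRingEnd 𝕜), RCLike.conj_ofReal,
      mul_left_comm, RCLike.mul_conj]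
    norm_cast
  · exact L2.integrable_inner (𝕜 := 𝕜) _ f

theorem norm_sq_eq_integral (f : L2I 𝕜) :
    ‖f‖ ^ 2 = ∫ x in Ioo (0 : ℝ) 1, ‖f x‖ ^ 2 := by
  rw [← inner_self_eq_norm_sq (𝕜 := 𝕜), L2.inner_def, ← RCLike.reCLM_apply,
    ← ContinuousLinearMap.integral_comp_comm _ (L2.integrable_inner (𝕜 := 𝕜) f f)]
  refine integral_congr_ae (Eventually.of_forall fun x => ?_)
  simp only [RCLike.reCLM_apply, inner_self_eq_norm_sq]

/-- The symmetrised integrand is what the product rule produces for expressions such as |F|², so the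
identities below can be computed in `𝕜` before returning to real numbers. -/
theorem two_mul_re_inner (f g : L2I 𝕜) :
    ((2 * RCLike.re (inner 𝕜 f g) : ℝ) : 𝕜)
      = ∫ x in (0 : ℝ)..1, (g x * starRingEnd 𝕜 (f x) + f x * starRingEnd 𝕜 (g x)) := by
  rw [intervalIntegral.integral_add (intervalIntegrable_mul_conj f g)
    (intervalIntegrable_mul_conj g f), ← inner_eq_integral, ← inner_eq_integral,
    ← inner_conj_symm g f, RCLike.add_conj]
  push_cast
  rfl

theorem intervalIntegral_congr_Ioo {f g : ℝ → 𝕜}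
    (h : ∀ᵐ x ∂((volume : Measure ℝ).restrict (Ioo (0 : ℝ) 1)), f x = g x) :
    ∫ x in (0 : ℝ)..1, f x = ∫ x in (0 : ℝ)..1, g x := by
  rw [← setIntegral_Ioo_eq, ← setIntegral_Ioo_eq]
  exact integral_congr_ae h

theorem isPrimitive_coordinate : IsPrimitive (fun _ : ℝ => (1 : 𝕜)) (fun x : ℝ => (x : 𝕜)) :=
  .of_hasDerivAt (fun x => by
    simpa using (RCLike.ofRealCLM (K := 𝕜)).hasFDerivAt.comp_hasDerivAt x (hasDerivAt_id x))
    continuous_const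

namespace AiryProfile

variable {β : ℝ} {v w v₁ : L2I 𝕜} {c : 𝕜}

/-- The function E = 2 Re(v̄ v_xx) - |v_x|² has derivative 2 Re(v̄ v_xxx) = -2 Re(v̄ w). Since v
vanishes at both ends, only |v_x|² contributes to the boundary terms. -/
theorem two_mul_re_inner_eq (h : AiryProfile β v w v₁ c) :
    2 * RCLike.re (inner 𝕜 v w) = -((1 - β ^ 2) * ‖c‖ ^ 2) := by
  obtain ⟨F₀, F₁, F₂, p0, p1, p2, e0, e1, a0, a1, b0, b1⟩ := h
  have key := (((p0.conj.mul p2).add (p0.mul p2.conj)).sub (p1.mul p1.conj)).integral_eq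
  have e : ∫ x in (0 : ℝ)..1, (starRingEnd 𝕜 (F₁ x) * F₂ x + starRingEnd 𝕜 (F₀ x) * -w x +
      (F₁ x * starRingEnd 𝕜 (F₂ x) + F₀ x * starRingEnd 𝕜 (-w x)) -
      (F₂ x * starRingEnd 𝕜 (F₁ x) + F₁ x * starRingEnd 𝕜 (F₂ x)))
      = -((2 * RCLike.re (inner 𝕜 v w) : ℝ) : 𝕜) := by
    rw [two_mul_re_inner, ← intervalIntegral.integral_neg]
    refine intervalIntegral_congr_Ioo (e0.mono fun x hx => ?_)
    rw [hx, map_neg]; ring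
  rw [e] at key
  simp only [a0, a1, b0, b1, map_zero, zero_mul, add_zero, zero_sub, map_mul,
    RCLike.conj_ofReal] at key
  have k2 : (β : 𝕜) * c * (β * starRingEnd 𝕜 c) = ((β ^ 2 * ‖c‖ ^ 2 : ℝ) : 𝕜) := by
    rw [mul_mul_mul_comm, RCLike.mul_conj]; push_cast; ring
  rw [k2, RCLike.mul_conj] at key
  norm_cast at key
  linarith

/-- With E as in `two_mul_re_inner_eq`, integrate the derivative of xE - 2 Re(v̄ v_x): the v̄ v_xx
terms cancel and leave -3|v_x|² - 2x Re(v̄ w). The weight x removes the boundary term of E at 0. -/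
theorem three_mul_norm_sq_eq (h : AiryProfile β v w v₁ c) :
    3 * ‖v₁‖ ^ 2 = β ^ 2 * ‖c‖ ^ 2 - 2 * RCLike.re (inner 𝕜 (mulCoord v) w) := by
  obtain ⟨F₀, F₁, F₂, p0, p1, p2, e0, e1, a0, a1, b0, b1⟩ := h
  have pE := ((p0.conj.mul p2).add (p0.mul p2.conj)).sub (p1.mul p1.conj)
  have key := ((isPrimitive_coordinate.mul pE).sub
    ((p0.conj.mul p1).add (p0.mul p1.conj))).integral_eq
  have hi := (intervalIntegrable_mul_conj v₁ v₁).const_mul (3 : 𝕜)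
  have hj := (intervalIntegrable_mul_conj (mulCoord v) w).add
    (intervalIntegrable_mul_conj w (mulCoord v))
  have e : ((3 * ‖v₁‖ ^ 2 + 2 * RCLike.re (inner 𝕜 (mulCoord v) w) : ℝ) : 𝕜)
      = ((β ^ 2 * ‖c‖ ^ 2 : ℝ) : 𝕜) := by
    have k2 : (β : 𝕜) * c * (β * starRingEnd 𝕜 c) = ((β ^ 2 * ‖c‖ ^ 2 : ℝ) : 𝕜) := by
      rw [mul_mul_mul_comm, RCLike.mul_conj]; push_cast; ring
    rw [RCLike.ofReal_add, two_mul_re_inner, RCLike.ofReal_mul, RCLike.ofReal_pow,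
      ← inner_self_eq_norm_sq_to_K (𝕜 := 𝕜), inner_eq_integral, ← k2, RCLike.ofReal_ofNat,
      ← intervalIntegral.integral_const_mul, ← intervalIntegral.integral_add hi hj]
    simp only [a0, a1, b0, b1, map_zero, zero_mul, add_zero, zero_sub, map_mul, sub_zero,
      RCLike.conj_ofReal, RCLike.ofReal_one, one_mul] at key
    rw [← neg_eq_iff_eq_neg.2 key, ← intervalIntegral.integral_neg]
    refine intervalIntegral_congr_Ioo ?_
    filter_upwards [e0, e1, coeFn_mulCoord v] with x h0 h1 h2
    rw [h2, h0, h1, map_neg, map_mul, RCLike.conj_ofReal]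
    ring
  have e := RCLike.ofReal_injective e
  linarith

/-- A form of the Poincaré inequality. -/
theorem norm_sq_eq (h : AiryProfile β v w v₁ c) :
    ‖v‖ ^ 2 = - (2 * RCLike.re (inner 𝕜 (mulCoord v) v₁)) := by
  obtain ⟨F₀, F₁, F₂, p0, p1, p2, e0, e1, a0, a1, b0, b1⟩ := h
  -- The function x|v|² vanishes at both endpoints.
  have key := (isPrimitive_coordinate.mul (p0.mul p0.conj)).integral_eq
  have hi := intervalIntegrable_mul_conj v v
  have hj := (intervalIntegrable_mul_conj (mulCoord v) v₁).add
    (intervalIntegrable_mul_conj v₁ (mulCoord v))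
  have e : ((‖v‖ ^ 2 + 2 * RCLike.re (inner 𝕜 (mulCoord v) v₁) : ℝ) : 𝕜) = ((0 : ℝ) : 𝕜) := by
    rw [RCLike.ofReal_add, two_mul_re_inner, RCLike.ofReal_pow,
      ← inner_self_eq_norm_sq_to_K (𝕜 := 𝕜), inner_eq_integral,
      ← intervalIntegral.integral_add hi hj]
    simp only [a0, a1, map_zero, mul_zero, sub_zero] at key
    rw [RCLike.ofReal_zero, ← key]
    refine intervalIntegral_congr_Ioo ?_
    filter_upwards [e0, e1, coeFn_mulCoord v] with x h0 h1 h2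
    rw [h2, h0, h1, map_mul, RCLike.conj_ofReal]
    ring
  have e := RCLike.ofReal_injective e
  linarith

/-- Cauchy–Schwarz in `norm_sq_eq`, divided by ‖v‖. The size of the constant is irrelevant for the
decay. -/
theorem norm_le (h : AiryProfile β v w v₁ c) : ‖v‖ ≤ 2 * ‖mulCoord (𝕜 := 𝕜)‖ * ‖v₁‖ := by
  have h1 := (abs_le.1 ((RCLike.abs_re_le_norm _).trans (norm_inner_le_norm (𝕜 := 𝕜)
    (mulCoord v) v₁))).1
  have h2 := mul_le_mul_of_nonneg_right ((mulCoord (𝕜 := 𝕜)).le_opNorm v) (norm_nonneg v₁)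
  have h3 := h.norm_sq_eq
  rcases (norm_nonneg v).eq_or_lt with h0 | h0
  · rw [← h0]; positivity
  · refine le_of_mul_le_mul_right ?_ h0
    nlinarith

end AiryProfile

end Energy

/-! ### Difference quotients in time and their L² limits -/

section DifferenceQuotient

variable {E : Type*} [NormedAddCommGroup E]

theorem norm_toLp_sq {α : Type*} [MeasurableSpace α] {μ : Measure α} {f : α → E}
    (hf : MemLp f 2 μ) : ‖hf.toLp f‖ ^ 2 = ∫ x, ‖f x‖ ^ 2 ∂μ := by
  rw [Lp.norm_toLp, hf.eLpNorm_eq_integral_rpow_norm two_ne_zero ENNReal.ofNat_ne_top,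
    ENNReal.toReal_ofReal (by positivity), ← Real.rpow_natCast, ← Real.rpow_mul (by positivity)]
  norm_num

theorem integral_Ioi_norm_sq_le {f : ℝ → E} (hf : Continuous f) {B : ℝ}
    (hB : ∀ T, 0 ≤ T → ∫ s in (0 : ℝ)..T, ‖f s‖ ^ 2 ≤ B) :
    MemLp f 2 (volume.restrict (Ioi 0)) ∧ ∫ s in Ioi (0 : ℝ), ‖f s‖ ^ 2 ≤ B := by
  have hc : Continuous fun s => ‖f s‖ ^ 2 := hf.norm.pow 2
  have hi : IntegrableOn (fun s => ‖f s‖ ^ 2) (Ioi 0) := by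
    refine integrableOn_Ioi_of_intervalIntegral_norm_bounded (l := atTop) (b := id) B 0
      (fun T => (hc.integrableOn_Icc).mono_set Ioc_subset_Icc_self) tendsto_id ?_
    filter_upwards [eventually_ge_atTop 0] with T hT
    simpa using hB T hT
  refine ⟨(memLp_two_iff_integrable_sq_norm hf.aestronglyMeasurable).2 hi, ?_⟩
  refine le_of_tendsto (intervalIntegral_tendsto_integral_Ioi 0 hi tendsto_id) ?_
  filter_upwards [eventually_ge_atTop 0] with T hT using hB T hT

variable [NormedSpace ℝ E]

/-- The forward difference quotient of `C` with step `h`. -/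
def diffQuot (C : ℝ → E) (h t : ℝ) : E := h⁻¹ • (C (t + h) - C t)

theorem continuous_diffQuot {C : ℝ → E} (hC : Continuous C) (h : ℝ) :
    Continuous (diffQuot C h) := by
  unfold diffQuot
  fun_prop

theorem tendsto_diffQuot_of_hasDerivAt {C : ℝ → E} {c : E} {t : ℝ} (hC : HasDerivAt C c t)
    {h : ℕ → ℝ} (hpos : ∀ n, 0 < h n) (hlim : Tendsto h atTop (𝓝 0)) :
    Tendsto (fun n => diffQuot C (h n) t) atTop (𝓝 c) :=
  hC.tendsto_slope_zero.comp
    (tendsto_nhdsWithin_iff.2 ⟨hlim, Eventually.of_forall fun n => (hpos n).ne'⟩)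

/-- Translating the integration variable moves the quotient onto the primitive, at the cost of a
term at time 0; that term tends to `C 0`. -/
theorem integral_diffQuot {C : ℝ → E} (hC : Continuous C) (h t : ℝ) :
    ∫ s in (0 : ℝ)..t, diffQuot C h s
      = diffQuot (fun x => ∫ s in (0 : ℝ)..x, C s) h t
        - diffQuot (fun x => ∫ s in (0 : ℝ)..x, C s) h 0 := by
  have hi : ∀ a b : ℝ, IntervalIntegrable C volume a b := fun a b => hC.intervalIntegrable a b
  have hs : IntervalIntegrable (fun s => C (s + h)) volume 0 t :=
    (hC.comp (continuous_id.add continuous_const)).intervalIntegrable _ _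
  simp only [diffQuot]
  rw [intervalIntegral.integral_smul, intervalIntegral.integral_sub hs (hi _ _),
    intervalIntegral.integral_comp_add_right, ← smul_sub, ← intervalIntegral.integral_interval_sub_left
    (hi 0 (t + h)) (hi 0 (0 + h)), intervalIntegral.integral_same, sub_zero]
  congr 1
  abel

variable [CompleteSpace E]

theorem hasDerivAt_integral_zero {C : ℝ → E} (hC : Continuous C) (t : ℝ) :
    HasDerivAt (fun x => ∫ s in (0 : ℝ)..x, C s) (C t) t :=
  (hC.integral_hasStrictDerivAt 0 t).hasDerivAt

theorem tendsto_integral_diffQuot {C : ℝ → E} (hC : Continuous C) (hC0 : C 0 = 0) {h : ℕ → ℝ}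
    (hpos : ∀ n, 0 < h n) (hlim : Tendsto h atTop (𝓝 0)) (t : ℝ) :
    Tendsto (fun n => ∫ s in (0 : ℝ)..t, diffQuot C (h n) s) atTop (𝓝 (C t)) := by
  simp only [integral_diffQuot hC]
  have := (tendsto_diffQuot_of_hasDerivAt (hasDerivAt_integral_zero hC t) hpos hlim).sub
    (tendsto_diffQuot_of_hasDerivAt (hasDerivAt_integral_zero hC 0) hpos hlim)
  rwa [hC0, sub_zero] at this

/-- A continuous function whose difference quotients form a Cauchy sequence in `L²(0,∞)` is the
primitive of their limit. -/
theorem exists_l2_limit_diffQuot {C : ℝ → E} (hC : Continuous C) (hC0 : C 0 = 0) {h : ℕ → ℝ}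
    (hpos : ∀ n, 0 < h n) (hlim : Tendsto h atTop (𝓝 0)) {H : Type*} [NormedAddCommGroup H]
    {p : ℕ → H} (hp : CauchySeq p) {M : ℝ} (hM : 0 ≤ M)
    (hbound : ∀ n T, 0 ≤ T → ∫ s in (0 : ℝ)..T, ‖diffQuot C (h n) s‖ ^ 2 ≤ M * ‖p n‖ ^ 2)
    (hcauchy : ∀ n m T, 0 ≤ T →
      ∫ s in (0 : ℝ)..T, ‖diffQuot C (h n) s - diffQuot C (h m) s‖ ^ 2 ≤ M * ‖p n - p m‖ ^ 2) :
    ∃ g : ℝ → E, MemLp g 2 (volume.restrict (Ioi 0)) ∧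
      (∀ t, 0 ≤ t → IntervalIntegrable g volume 0 t ∧ ∫ s in (0 : ℝ)..t, g s = C t ∧
        Tendsto (fun n => ∫ s in (0 : ℝ)..t, ‖diffQuot C (h n) s‖ ^ 2) atTop
          (𝓝 (∫ s in (0 : ℝ)..t, ‖g s‖ ^ 2))) ∧
      ∃ ns : ℕ → ℕ, StrictMono ns ∧ ∀ᵐ s ∂((volume : Measure ℝ).restrict (Ioi 0)),
        Tendsto (fun k => diffQuot C (h (ns k)) s) atTop (𝓝 (g s)) := by
  have hD := fun n => continuous_diffQuot hC (h n)
  have hmem := fun n => (integral_Ioi_norm_sq_le (hD n) (hbound n)).1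
  -- Letting T tend to infinity in `hcauchy` makes the quotients depend Lipschitz-continuously on
  -- `p`, with values in L²(0,∞).
  have hdist : ∀ n m, dist ((hmem n).toLp _) ((hmem m).toLp _) ≤ √M * dist (p n) (p m) := by
    intro n m
    rw [dist_eq_norm, ← MemLp.toLp_sub, dist_eq_norm]
    refine le_of_sq_le_sq ?_ (by positivity)
    rw [norm_toLp_sq, mul_pow, Real.sq_sqrt hM]
    exact (integral_Ioi_norm_sq_le ((hD n).sub (hD m)) (hcauchy n m)).2
  have hcs : CauchySeq fun n => (hmem n).toLp _ := by
    rw [Metric.cauchySeq_iff'] at hp ⊢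
    intro ε hε
    obtain ⟨N, hN⟩ := hp (ε / (√M + 1)) (by positivity)
    refine ⟨N, fun n hn => (hdist n N).trans_lt ?_⟩
    calc √M * dist (p n) (p N) ≤ (√M + 1) * dist (p n) (p N) := by gcongr; linarith
      _ < (√M + 1) * (ε / (√M + 1)) := by gcongr; exact hN n hn
      _ = ε := by field_simp
  obtain ⟨G, hG⟩ := cauchySeq_tendsto_of_complete hcs
  obtain ⟨g, hgm, hg⟩ : ∃ g : ℝ → E, MemLp g 2 (volume.restrict (Ioi 0)) ∧
      Tendsto (fun n => eLpNorm (diffQuot C (h n) - g) 2 (volume.restrict (Ioi 0)))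
        atTop (𝓝 0) := by
    refine ⟨G, Lp.memLp G, ?_⟩
    rwa [← Lp.toLp_coeFn G (Lp.memLp G), Lp.tendsto_Lp_iff_tendsto_eLpNorm''] at hG
  refine ⟨g, hgm, fun t ht => ?_, ?_⟩
  · have hle : (volume : Measure ℝ).restrict (Ioc 0 t) ≤ volume.restrict (Ioi 0) :=
      Measure.restrict_mono Ioc_subset_Ioi_self le_rfl
    have hg' : Tendsto (fun n => eLpNorm (diffQuot C (h n) - g) 2 (volume.restrict (Ioc 0 t)))
        atTop (𝓝 0) :=
      tendsto_of_tendsto_of_tendsto_of_le_of_le tendsto_const_nhds hg (fun _ => zero_le)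
        fun n => eLpNorm_mono_measure _ hle
    have hm' := fun n => (hmem n).mono_measure hle
    have hgm' := hgm.mono_measure hle
    have hgi : IntegrableOn g (Ioc 0 t) := hgm'.integrable one_le_two
    refine ⟨(intervalIntegrable_iff_integrableOn_Ioc_of_le ht).2 hgi, ?_, ?_⟩
    -- On a bounded interval L² convergence implies L¹ convergence, so the integrals of the
    -- quotients tend both to that of `g` and to `C t`.
    · refine tendsto_nhds_unique ?_ (tendsto_integral_diffQuot hC hC0 hpos hlim t)
      simp only [intervalIntegral.integral_of_le ht]
      refine tendsto_integral_of_L1' _ hgi.aestronglyMeasurable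
        (Eventually.of_forall fun n => (hm' n).integrable one_le_two) ?_
      refine tendsto_of_tendsto_of_tendsto_of_le_of_le tendsto_const_nhds ?_ (fun _ => zero_le)
        fun n => eLpNorm_le_eLpNorm_mul_rpow_measure_univ one_le_two
          ((hm' n).sub hgm').aestronglyMeasurable
      have := ENNReal.Tendsto.mul_const (b := (volume.restrict (Ioc 0 t) univ : ENNReal) ^
        (1 / (1 : ENNReal).toReal - 1 / (2 : ENNReal).toReal)) hg' (Or.inr (by
          refine ENNReal.rpow_ne_top_of_nonneg (by norm_num) (by simp)))
      rwa [zero_mul] at this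
    · simp only [intervalIntegral.integral_of_le ht]
      have := ((Lp.tendsto_Lp_iff_tendsto_eLpNorm'' _ hm' _ hgm').2 hg').norm.pow 2
      simpa only [norm_toLp_sq] using this
  · exact (tendstoInMeasure_of_tendsto_eLpNorm two_ne_zero
      (fun n => (hmem n).aestronglyMeasurable) hgm.aestronglyMeasurable hg).exists_seq_tendsto_ae

end DifferenceQuotient

/-! ### Energy estimates for continuously differentiable solutions -/

section ClassicalSolution

variable {𝕜 : Type*} [RCLike 𝕜]

theorem re_inner_mulCoord_nonneg (f : L2I 𝕜) : 0 ≤ RCLike.re (inner 𝕜 (mulCoord f) f) := by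
  rw [re_inner_mulCoord_self]
  exact setIntegral_nonneg measurableSet_Ioo fun x hx => mul_nonneg hx.1.le (sq_nonneg _)

theorem re_inner_mulCoord_le (f : L2I 𝕜) :
    RCLike.re (inner 𝕜 (mulCoord f) f) ≤ ‖f‖ ^ 2 := by
  have hi : IntegrableOn (fun x => ‖f x‖ ^ 2) (Ioo (0 : ℝ) 1) :=
    (memLp_two_iff_integrable_sq_norm (Lp.aestronglyMeasurable f)).1 (Lp.memLp f)
  rw [re_inner_mulCoord_self, norm_sq_eq_integral]
  refine setIntegral_mono_on (hi.bdd_mul (c := 1) continuous_id.aestronglyMeasurable ?_) hi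
    measurableSet_Ioo fun x hx => mul_le_of_le_one_left (sq_nonneg _) hx.2.le
  filter_upwards [ae_restrict_mem measurableSet_Ioo] with x hx
  change ‖x‖ ≤ 1
  rw [Real.norm_of_nonneg hx.1.le]
  exact hx.2.le

/-- For symmetric `A`, the form Re⟨Ay, y⟩ has time derivative 2 Re⟨Ay, y'⟩. It is applied to the
identity and to `mulCoord`. -/
theorem re_inner_sub_eq_integral {A : L2I 𝕜 →L[𝕜] L2I 𝕜}
    (hA : ∀ f g, inner 𝕜 (A f) g = inner 𝕜 f (A g)) {y w : ℝ → L2I 𝕜}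
    (hy : ∀ t, HasDerivAt y (w t) t) (hw : Continuous w) (t : ℝ) :
    RCLike.re (inner 𝕜 (A (y t)) (y t)) - RCLike.re (inner 𝕜 (A (y 0)) (y 0))
      = ∫ s in (0 : ℝ)..t, 2 * RCLike.re (inner 𝕜 (A (y s)) (w s)) := by
  have hyc : Continuous y := continuous_iff_continuousAt.2 fun t => (hy t).continuousAt
  have hd : ∀ s, HasDerivAt (fun s => RCLike.re (inner 𝕜 (A (y s)) (y s)))
      (2 * RCLike.re (inner 𝕜 (A (y s)) (w s))) s := by
    intro s
    have h1 : HasDerivAt (fun s => A (y s)) (A (w s)) s :=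
      (A.restrictScalars ℝ).hasFDerivAt.comp_hasDerivAt s (hy s)
    have h2 := (RCLike.reCLM (K := 𝕜)).hasFDerivAt.comp_hasDerivAt s (h1.inner 𝕜 (hy s))
    refine h2.congr_deriv ?_
    rw [RCLike.reCLM_apply, map_add, hA (w s), inner_re_symm (w s)]
    ring
  rw [intervalIntegral.integral_eq_sub_of_hasDerivAt (fun s _ => hd s)]
  have hc : Continuous fun s => 2 * RCLike.re (inner 𝕜 (A (y s)) (w s)) :=
    continuous_const.mul (RCLike.continuous_re.comp ((A.continuous.comp hyc).inner hw))
  exact hc.intervalIntegrable _ _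

/-- A continuously differentiable solution of `y' = i T_β y`, with `z = y_x` and
`c = y_x(0,·)`. -/
structure IsClassicalSolution (β : ℝ) (y w z : ℝ → L2I 𝕜) (c : ℝ → 𝕜) : Prop where
  hasDerivAt : ∀ t, HasDerivAt y (w t) t
  continuous_w : Continuous w
  continuous_z : Continuous z
  continuous_c : Continuous c
  profile : ∀ t, 0 ≤ t → AiryProfile β (y t) (w t) (z t) (c t)

namespace IsClassicalSolution

variable {β : ℝ} {y w z y' w' z' : ℝ → L2I 𝕜} {c c' : ℝ → 𝕜}

theorem sub (h : IsClassicalSolution β y w z c) (h' : IsClassicalSolution β y' w' z' c') :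
    IsClassicalSolution β (fun t => y t - y' t) (fun t => w t - w' t) (fun t => z t - z' t)
      (fun t => c t - c' t) where
  hasDerivAt t := (h.hasDerivAt t).sub (h'.hasDerivAt t)
  continuous_w := h.continuous_w.sub h'.continuous_w
  continuous_z := h.continuous_z.sub h'.continuous_z
  continuous_c := h.continuous_c.sub h'.continuous_c
  profile t ht := (h.profile t ht).sub (h'.profile t ht)

variable {t : ℝ}

theorem energy_eq (h : IsClassicalSolution β y w z c) (ht : 0 ≤ t) :
    ‖y t‖ ^ 2 + (1 - β ^ 2) * ∫ s in (0 : ℝ)..t, ‖c s‖ ^ 2 = ‖y 0‖ ^ 2 := by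
  have key := re_inner_sub_eq_integral (A := ContinuousLinearMap.id 𝕜 (L2I 𝕜)) (fun _ _ => rfl)
    h.hasDerivAt h.continuous_w t
  simp only [ContinuousLinearMap.id_apply, inner_self_eq_norm_sq] at key
  have e : ∫ s in (0 : ℝ)..t, 2 * RCLike.re (inner 𝕜 (y s) (w s))
      = ∫ s in (0 : ℝ)..t, -((1 - β ^ 2) * ‖c s‖ ^ 2) := by
    refine intervalIntegral.integral_congr fun s hs => ?_
    rw [uIcc_of_le ht] at hs
    exact (h.profile s hs.1).two_mul_re_inner_eq
  rw [e, intervalIntegral.integral_neg, intervalIntegral.integral_const_mul] at key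
  linarith

theorem weighted_energy_eq (h : IsClassicalSolution β y w z c) (ht : 0 ≤ t) :
    RCLike.re (inner 𝕜 (mulCoord (y t)) (y t)) + 3 * ∫ s in (0 : ℝ)..t, ‖z s‖ ^ 2
      = RCLike.re (inner 𝕜 (mulCoord (y 0)) (y 0)) + β ^ 2 * ∫ s in (0 : ℝ)..t, ‖c s‖ ^ 2 := by
  have key := re_inner_sub_eq_integral inner_mulCoord_left h.hasDerivAt h.continuous_w t
  have e : ∫ s in (0 : ℝ)..t, 2 * RCLike.re (inner 𝕜 (mulCoord (y s)) (w s))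
      = ∫ s in (0 : ℝ)..t, (β ^ 2 * ‖c s‖ ^ 2 - 3 * ‖z s‖ ^ 2) := by
    refine intervalIntegral.integral_congr fun s hs => ?_
    rw [uIcc_of_le ht] at hs
    have := (h.profile s hs.1).three_mul_norm_sq_eq
    linarith
  rw [e, intervalIntegral.integral_sub, intervalIntegral.integral_const_mul,
    intervalIntegral.integral_const_mul] at key
  · linarith
  · exact ((h.continuous_c.norm.pow 2).const_mul _).intervalIntegrable _ _
  · exact ((h.continuous_z.norm.pow 2).const_mul _).intervalIntegrable _ _

theorem norm_sq_antitone (h : IsClassicalSolution β y w z c) (hβ : 0 < 1 - β ^ 2) {s : ℝ}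
    (hs : 0 ≤ s) (hst : s ≤ t) : ‖y t‖ ^ 2 ≤ ‖y s‖ ^ 2 := by
  have h1 := h.energy_eq hs
  have h2 := h.energy_eq (hs.trans hst)
  have h3 : ∫ r in (0 : ℝ)..s, ‖c r‖ ^ 2 ≤ ∫ r in (0 : ℝ)..t, ‖c r‖ ^ 2 :=
    intervalIntegral.integral_mono_interval le_rfl hs hst
      (Eventually.of_forall fun _ => sq_nonneg _)
      ((h.continuous_c.norm.pow 2).intervalIntegrable _ _)
  have := mul_le_mul_of_nonneg_left h3 hβ.le
  linarith

theorem norm_sq_le (h : IsClassicalSolution β y w z c) (hβ : 0 < 1 - β ^ 2) (ht : 0 ≤ t) :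
    ‖y t‖ ^ 2 ≤ ‖y 0‖ ^ 2 :=
  h.norm_sq_antitone hβ le_rfl ht

theorem integral_trace_le (h : IsClassicalSolution β y w z c) (hβ : 0 < 1 - β ^ 2) (ht : 0 ≤ t) :
    ∫ s in (0 : ℝ)..t, ‖c s‖ ^ 2 ≤ 1 / (1 - β ^ 2) * ‖y 0‖ ^ 2 := by
  have h1 := h.energy_eq ht
  rw [one_div, ← div_eq_inv_mul, le_div_iff₀ hβ]
  nlinarith [sq_nonneg ‖y t‖]

theorem weighted_energy_le (h : IsClassicalSolution β y w z c) (hβ : 0 < 1 - β ^ 2)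
    (ht : 0 ≤ t) :
    RCLike.re (inner 𝕜 (mulCoord (y t)) (y t)) + 3 * ∫ s in (0 : ℝ)..t, ‖z s‖ ^ 2
      ≤ 1 / (1 - β ^ 2) * ‖y 0‖ ^ 2 := by
  rw [h.weighted_energy_eq ht]
  have h1 := mul_le_mul_of_nonneg_left (h.integral_trace_le hβ ht) (sq_nonneg β)
  have h2 := re_inner_mulCoord_le (y 0)
  -- The constant satisfies K = 1 + β²K: the initial weighted energy plus the boundary contribution.
  have h3 : 1 / (1 - β ^ 2) * ‖y 0‖ ^ 2
      = ‖y 0‖ ^ 2 + β ^ 2 * (1 / (1 - β ^ 2) * ‖y 0‖ ^ 2) := by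
    field_simp; ring
  linarith

/-- The factor 3 is given away so that the same constant serves for the trace and for the gradient.
-/
theorem integral_deriv_le (h : IsClassicalSolution β y w z c) (hβ : 0 < 1 - β ^ 2)
    (ht : 0 ≤ t) :
    ∫ s in (0 : ℝ)..t, ‖z s‖ ^ 2 ≤ 1 / (1 - β ^ 2) * ‖y 0‖ ^ 2 := by
  have h1 := h.weighted_energy_le hβ ht
  have h2 := re_inner_mulCoord_nonneg (y t)
  have h3 : 0 ≤ ∫ s in (0 : ℝ)..t, ‖z s‖ ^ 2 :=
    intervalIntegral.integral_nonneg ht fun _ _ => sq_nonneg _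
  linarith

/-- As the norm is nonincreasing, t‖y(t)‖² is at most ∫₀ᵗ‖y‖², which Poincaré bounds by the gradient
integral. -/
theorem mul_norm_sq_le (h : IsClassicalSolution β y w z c) (hβ : 0 < 1 - β ^ 2) (ht : 0 ≤ t) :
    t * ‖y t‖ ^ 2
      ≤ (2 * ‖mulCoord (𝕜 := 𝕜)‖) ^ 2 * (1 / (1 - β ^ 2)) * ‖y 0‖ ^ 2 := by
  calc t * ‖y t‖ ^ 2 = ∫ _ in (0 : ℝ)..t, ‖y t‖ ^ 2 := by simp
    _ ≤ ∫ s in (0 : ℝ)..t, (2 * ‖mulCoord (𝕜 := 𝕜)‖) ^ 2 * ‖z s‖ ^ 2 := by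
      refine intervalIntegral.integral_mono_on ht (by simp)
        (((h.continuous_z.norm.pow 2).const_mul _).intervalIntegrable _ _) fun s hs => ?_
      rw [← mul_pow]
      exact (h.norm_sq_antitone hβ hs.1 hs.2).trans
        (pow_le_pow_left₀ (norm_nonneg _) (h.profile s hs.1).norm_le 2)
    _ ≤ _ := by
      rw [intervalIntegral.integral_const_mul, mul_assoc]
      exact mul_le_mul_of_nonneg_left (h.integral_deriv_le hβ ht) (sq_nonneg _)

end IsClassicalSolution

theorem integral_test_smul_eq_inner {φ : ℝ → ℝ} (hφ : Continuous φ) (hc : HasCompactSupport φ) :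
    ∃ a : L2I 𝕜, ∀ f : L2I 𝕜, ∫ x in Ioo (0 : ℝ) 1, φ x • f x = inner 𝕜 a f := by
  have hm : MemLp (fun x => (φ x : 𝕜)) 2 ((volume : Measure ℝ).restrict (Ioo (0 : ℝ) 1)) := by
    obtain ⟨C, hC⟩ := hc.exists_bound_of_continuous hφ
    refine MemLp.of_bound (RCLike.continuous_ofReal.comp hφ).aestronglyMeasurable C
      (Eventually.of_forall fun x => ?_)
    simpa using hC x
  refine ⟨hm.toLp, fun f => ?_⟩
  rw [L2.inner_def]
  refine integral_congr_ae ?_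
  filter_upwards [hm.coeFn_toLp] with x hx
  rw [hx, RCLike.inner_apply, RCLike.conj_ofReal, RCLike.real_smul_eq_coe_mul, mul_comm]

/-- Both sides of the defining identity are L² inner products with fixed functions, hence
continuous: the weak derivative is a closed operator. -/
theorem hasWeakDeriv_of_tendsto {f g : ℕ → L2I 𝕜} {f₀ g₀ : L2I 𝕜}
    (h : ∀ n, HasWeakDeriv (f n) (g n)) (hf : Tendsto f atTop (𝓝 f₀))
    (hg : Tendsto g atTop (𝓝 g₀)) : HasWeakDeriv f₀ g₀ := by
  intro φ hφ hc hs
  obtain ⟨a, ha⟩ := integral_test_smul_eq_inner (𝕜 := 𝕜) hφ.continuous hc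
  obtain ⟨b, hb⟩ := integral_test_smul_eq_inner (𝕜 := 𝕜) (hφ.continuous_deriv (by simp)) hc.deriv
  rw [ha, hb]
  refine tendsto_nhds_unique (tendsto_const_nhds.inner hf) ?_
  refine (tendsto_const_nhds.inner hg).neg.congr fun n => ?_
  rw [← ha, ← hb, h n φ hφ hc hs]

end ClassicalSolution

/-! ### From classical to mild solutions -/

section MildSolution

variable {𝕜 : Type*} [RCLike 𝕜]

theorem continuous_of_norm_sub_sq_eq {E : Type*} [NormedAddCommGroup E] {f : ℝ → E}
    {q : ℝ → ℝ → ℝ} (hq : ∀ t, Continuous fun s => q s t) (h0 : ∀ t, q t t = 0)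
    (h : ∀ s t, ‖f s - f t‖ ^ 2 = q s t) : Continuous f := by
  refine continuous_iff_continuousAt.2 fun t => tendsto_iff_norm_sub_tendsto_zero.2 ?_
  have h1 : Tendsto (fun s => √(q s t)) (𝓝 t) (𝓝 0) := by
    simpa [h0] using ((hq t).tendsto t).sqrt
  refine h1.congr fun s => ?_
  rw [← h, Real.sqrt_sq (norm_nonneg _)]

/-- The integrated solution lies in the domain of `T_β`, with continuous first derivative and
boundary trace. -/
theorem IsMildSolution.exists_profile {β : ℝ} (hβ : 0 < 1 - β ^ 2) {u₀ : L2I 𝕜} {u : ℝ → L2I 𝕜}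
    (hu : IsMildSolution β u₀ u) :
    ∃ (U V Z : ℝ → L2I 𝕜) (C : ℝ → 𝕜), Continuous U ∧ (∀ t, 0 ≤ t → U t = u t) ∧
      V = (fun t => ∫ s in (0 : ℝ)..t, U s) ∧ (∀ t, 0 ≤ t → V t = ∫ s in (0 : ℝ)..t, u s) ∧
      Continuous Z ∧ Z 0 = 0 ∧ Continuous C ∧ C 0 = 0 ∧
      ∀ t, 0 ≤ t → AiryProfile β (V t) (U t - u₀) (Z t) (C t) := by
  -- Freezing `u` at its initial value for negative times makes it continuous on the whole line.
  set U : ℝ → L2I 𝕜 := fun t => u (max t 0) with hUdef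
  have hU : Continuous U :=
    hu.continuousOn.comp_continuous (continuous_id.max continuous_const) fun t =>
      mem_Ici.2 (le_max_right _ _)
  have hUu : ∀ t, 0 ≤ t → U t = u t := fun t ht => by simp only [hUdef, max_eq_left ht]
  set V : ℝ → L2I 𝕜 := fun t => ∫ s in (0 : ℝ)..t, U s with hVdef
  have hV : Continuous V := continuous_iff_continuousAt.2 fun t =>
    (hasDerivAt_integral_zero hU t).continuousAt
  have hVu : ∀ t, 0 ≤ t → V t = ∫ s in (0 : ℝ)..t, u s := fun t ht => by
    refine intervalIntegral.integral_congr fun s hs => hUu s ?_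
    rw [uIcc_of_le ht] at hs
    exact hs.1
  have hex : ∀ t, ∃ v₁ c, AiryProfile β (V (max t 0)) (U (max t 0) - u₀) v₁ c := fun t => by
    have ht : 0 ≤ max t 0 := le_max_right _ _
    rw [hVu _ ht, hUu _ ht]
    exact (hu.equation _ ht).exists_profile
  choose Z C hZC using hex
  have hm : Continuous fun t : ℝ => max t 0 := continuous_id.max continuous_const
  have hVm := hV.comp hm
  have hUm := hU.comp hm
  -- `Z` and `C` were chosen separately at each time. The multiplier identities for differences
  -- express ‖C s - C t‖² and ‖Z s - Z t‖² through continuous quantities, which yields their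
  -- continuity.
  have hdiff := fun s t => (hZC s).sub (hZC t)
  have hC2 : ∀ s t, ‖C s - C t‖ ^ 2 = -(2 * RCLike.re (inner 𝕜 (V (max s 0) - V (max t 0))
      (U (max s 0) - u₀ - (U (max t 0) - u₀)))) / (1 - β ^ 2) := fun s t => by
    rw [eq_div_iff hβ.ne', (hdiff s t).two_mul_re_inner_eq]
    ring
  have hC : Continuous C := by
    refine continuous_of_norm_sub_sq_eq (fun t => ?_) (fun t => ?_) hC2
    · exact (continuous_const.mul (RCLike.continuous_re.comp ((hVm.sub continuous_const).inner
        ((hUm.sub continuous_const).sub continuous_const)))).neg.div_const _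
    · simp
  have hZ : Continuous Z := by
    refine continuous_of_norm_sub_sq_eq (q := fun s t => (β ^ 2 * ‖C s - C t‖ ^ 2
      - 2 * RCLike.re (inner 𝕜 (mulCoord (V (max s 0) - V (max t 0)))
        (U (max s 0) - u₀ - (U (max t 0) - u₀)))) / 3) (fun t => ?_) (fun t => ?_) fun s t => ?_
    · exact ((continuous_const.mul ((hC.sub continuous_const).norm.pow 2)).sub
        (continuous_const.mul (RCLike.continuous_re.comp
          ((mulCoord.continuous.comp (hVm.sub continuous_const)).inner
            ((hUm.sub continuous_const).sub continuous_const))))).div_const _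
    · simp
    · rw [← (hdiff s t).three_mul_norm_sq_eq]
      ring
  -- At time 0 the image `U 0 - u₀` vanishes, so the same identities force `C 0 = 0` and then `Z 0 =
  -- 0`.
  have h0 := hZC 0
  have e0 : U 0 - u₀ = 0 := by rw [hUu 0 le_rfl, hu.initial, sub_self]
  have hC0 : C 0 = 0 := by
    have := h0.two_mul_re_inner_eq
    simp only [max_self, e0, inner_zero_right, map_zero, mul_zero, zero_eq_neg, mul_eq_zero,
      hβ.ne', false_or] at this
    simpa using this
  have hZ0 : Z 0 = 0 := by
    have := h0.three_mul_norm_sq_eq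
    simp only [max_self, e0, inner_zero_right, map_zero, mul_zero, hC0, norm_zero] at this
    simpa using this
  refine ⟨U, V, Z, C, hU, hUu, rfl, hVu, hZ, hZ0, hC, hC0, fun t ht => ?_⟩
  have := hZC t
  rwa [max_eq_left ht] at this

/-- In a difference of two profiles `u₀` cancels, leaving the increment of `U`, which is also the
time derivative of the increment of `V`. -/
theorem isClassicalSolution_diffQuot {β : ℝ} {u₀ : L2I 𝕜} {U V Z : ℝ → L2I 𝕜} {C : ℝ → 𝕜}
    (hU : Continuous U) (hV : V = fun t => ∫ s in (0 : ℝ)..t, U s) (hZ : Continuous Z)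
    (hC : Continuous C) (hp : ∀ t, 0 ≤ t → AiryProfile β (V t) (U t - u₀) (Z t) (C t))
    {h : ℝ} (hh : 0 < h) :
    IsClassicalSolution β (diffQuot V h) (diffQuot U h) (diffQuot Z h) (diffQuot C h) where
  hasDerivAt t := by
    subst hV
    exact (((hasDerivAt_integral_zero hU (t + h)).comp_add_const t h).sub
      (hasDerivAt_integral_zero hU t)).const_smul h⁻¹
  continuous_w := continuous_diffQuot hU h
  continuous_z := continuous_diffQuot hZ h
  continuous_c := continuous_diffQuot hC h
  profile t ht := by
    have := ((hp (t + h) (by positivity)).sub (hp t ht)).const_smul h⁻¹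
    rwa [sub_sub_sub_cancel_right] at this

theorem IsMildSolution.estimates {β : ℝ} (hβ : 0 < 1 - β ^ 2) {u₀ : L2I 𝕜} {u : ℝ → L2I 𝕜}
    (hu : IsMildSolution β u₀ u) :
    (∀ t : ℝ, 0 ≤ t → ‖u t‖ ^ 2 ≤ ‖u₀‖ ^ 2) ∧
    (∃ g : ℝ → 𝕜, IsDerivTraceAtZero u g ∧
      ∀ t : ℝ, 0 ≤ t → MemLp g 2 (volume.restrict (Ioo 0 t)) ∧
        ∫ s in (0 : ℝ)..t, ‖g s‖ ^ 2 ≤ 1 / (1 - β ^ 2) * ‖u₀‖ ^ 2) ∧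
    (∃ ux : ℝ → L2I 𝕜, IsSpatialDeriv u ux ∧
      ∀ t : ℝ, 0 ≤ t → MemLp ux 2 (volume.restrict (Ioo 0 t)) ∧
        RCLike.re (inner 𝕜 (mulCoord (u t)) (u t)) + 3 * (∫ s in (0 : ℝ)..t, ‖ux s‖ ^ 2)
          ≤ 1 / (1 - β ^ 2) * ‖u₀‖ ^ 2) ∧
    ∃ K : ℝ, ∀ t : ℝ, 0 ≤ t → t * ‖u t‖ ^ 2 ≤ K * ‖u₀‖ ^ 2 := by
  obtain ⟨U, V, Z, C, hU, hUu, hV, hVu, hZ, hZ0, hC, hC0, hp⟩ := hu.exists_profile hβ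
  have hU0 : U 0 = u₀ := by rw [hUu 0 le_rfl, hu.initial]
  set h : ℕ → ℝ := fun n => 1 / ((n : ℝ) + 1)
  have hpos : ∀ n, 0 < h n := fun n => Nat.one_div_pos_of_nat
  have hlim : Tendsto h atTop (𝓝 0) := tendsto_one_div_add_atTop_nhds_zero_nat
  have hsol := fun n => isClassicalSolution_diffQuot hU hV hZ hC hp (hpos n)
  have hconv : ∀ t, Tendsto (fun n => diffQuot V (h n) t) atTop (𝓝 (U t)) := fun t => by
    refine tendsto_diffQuot_of_hasDerivAt ?_ hpos hlim
    rw [hV]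
    exact hasDerivAt_integral_zero hU t
  have hconv0 : Tendsto (fun n => ‖diffQuot V (h n) 0‖ ^ 2) atTop (𝓝 (‖u₀‖ ^ 2)) :=
    hU0 ▸ (hconv 0).norm.pow 2
  have hM : 0 ≤ 1 / (1 - β ^ 2) := by positivity
  -- The controlling Cauchy sequence consists of the quotients at time 0, which converge to `u₀`.
  obtain ⟨g, hg, hgt, -⟩ := exists_l2_limit_diffQuot hC hC0 hpos hlim (hconv 0).cauchySeq hM
    (fun n T hT => (hsol n).integral_trace_le hβ hT)
    (fun n m T hT => ((hsol n).sub (hsol m)).integral_trace_le hβ hT)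
  obtain ⟨ux, hux, huxt, ns, hns, hae⟩ := exists_l2_limit_diffQuot hZ hZ0 hpos hlim
    (hconv 0).cauchySeq hM
    (fun n T hT => (hsol n).integral_deriv_le hβ hT)
    (fun n m T hT => ((hsol n).sub (hsol m)).integral_deriv_le hβ hT)
  have hsub : ∀ t : ℝ, (volume : Measure ℝ).restrict (Ioo 0 t) ≤ volume.restrict (Ioi 0) :=
    fun t => Measure.restrict_mono Ioo_subset_Ioi_self le_rfl
  refine ⟨fun t ht => ?_, ⟨g, fun t ht => ⟨(hgt t ht).1, ?_⟩, fun t ht => ⟨hg.mono_measure (hsub t),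
    ?_⟩⟩, ⟨ux, ?_, fun t ht => ⟨hux.mono_measure (hsub t), ?_⟩⟩,
    (2 * ‖mulCoord (𝕜 := 𝕜)‖) ^ 2 * (1 / (1 - β ^ 2)), fun t ht => ?_⟩
  · rw [← hUu t ht]
    exact le_of_tendsto_of_tendsto' ((hconv t).norm.pow 2) hconv0
      fun n => (hsol n).norm_sq_le hβ ht
  · rw [(hgt t ht).2.1, ← hVu t ht]
    exact (hp t ht).hasDerivTrace
  · exact le_of_tendsto_of_tendsto' (hgt t ht).2.2 (hconv0.const_mul _)
      fun n => (hsol n).integral_trace_le hβ ht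
  · unfold IsSpatialDeriv
    filter_upwards [hae, ae_restrict_mem measurableSet_Ioi] with s hs hs0
    have hs0 : 0 ≤ s := le_of_lt hs0
    rw [← hUu s hs0]
    -- Along the almost everywhere convergent subsequence both the quotients and their derivatives
    -- converge at time `s`.
    exact hasWeakDeriv_of_tendsto (fun k => ((hsol (ns k)).profile s hs0).hasWeakDeriv)
      ((hconv s).comp hns.tendsto_atTop) hs
  · rw [← hUu t ht]
    have h1 : Tendsto (fun n => RCLike.re (inner 𝕜 (mulCoord (diffQuot V (h n) t))
        (diffQuot V (h n) t))) atTop (𝓝 (RCLike.re (inner 𝕜 (mulCoord (U t)) (U t)))) :=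
      (RCLike.continuous_re.tendsto _).comp
        (((mulCoord.continuous.tendsto _).comp (hconv t)).inner (hconv t))
    exact le_of_tendsto_of_tendsto' (h1.add ((huxt t ht).2.2.const_mul 3)) (hconv0.const_mul _)
      fun n => (hsol n).weighted_energy_le hβ ht
  · rw [← hUu t ht]
    exact le_of_tendsto_of_tendsto' (((hconv t).norm.pow 2).const_mul t) (hconv0.const_mul _)
      fun n => (hsol n).mul_norm_sq_le hβ ht

end MildSolution

end AiryDirichlet

end

open AiryDirichlet
theorem proposition1 {𝕜 : Type*} [RCLike 𝕜] (β : ℝ) (hβ0 : 0 ≤ β) (hβ1 : β < 1)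
    (u₀ : L2I 𝕜) (u : ℝ → L2I 𝕜) (hu : IsMildSolution β u₀ u) :
    (∀ t : ℝ, 0 ≤ t → ‖u t‖ ^ 2 ≤ ‖u₀‖ ^ 2) ∧
    (∃ g : ℝ → 𝕜, IsDerivTraceAtZero u g ∧
      ∀ t : ℝ, 0 ≤ t → MemLp g 2 (volume.restrict (Ioo 0 t)) ∧
        ∫ s in (0 : ℝ)..t, ‖g s‖ ^ 2 ≤ 1 / (1 - β) * ‖u₀‖ ^ 2) ∧
    (∃ ux : ℝ → L2I 𝕜, IsSpatialDeriv u ux ∧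
      ∀ t : ℝ, 0 ≤ t → MemLp ux 2 (volume.restrict (Ioo 0 t)) ∧
        (∫ x in Ioo (0 : ℝ) 1, x * ‖u t x‖ ^ 2)
            + 3 * (∫ s in (0 : ℝ)..t, ∫ x in Ioo (0 : ℝ) 1, ‖ux s x‖ ^ 2)
          ≤ 1 / (1 - β) * ‖u₀‖ ^ 2) ∧
    Tendsto (fun t : ℝ => ‖u t‖ ^ 2) atTop (𝓝 0) := by
  -- The multipliers give the constant 1/(1-β²), which is at most the stated 1/(1-β).
  have hsq : β ^ 2 ≤ β := by nlinarith
  have hβ : 0 < 1 - β ^ 2 := by linarith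
  have hle : 1 / (1 - β ^ 2) * ‖u₀‖ ^ 2 ≤ 1 / (1 - β) * ‖u₀‖ ^ 2 := by
    gcongr
  obtain ⟨h1, ⟨g, hg, hg'⟩, ⟨ux, hux, hux'⟩, K, hK⟩ := hu.estimates hβ
  refine ⟨h1, ⟨g, hg, fun t ht => ⟨(hg' t ht).1, (hg' t ht).2.trans hle⟩⟩,
    ⟨ux, hux, fun t ht => ⟨(hux' t ht).1, ?_⟩⟩, ?_⟩
  · simp only [← norm_sq_eq_integral, ← re_inner_mulCoord_self]
    exact (hux' t ht).2.trans hle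
  · refine squeeze_zero' (Eventually.of_forall fun _ => sq_nonneg _) ?_
      (tendsto_const_nhds.div_atTop tendsto_id (a := K * ‖u₀‖ ^ 2))
    filter_upwards [eventually_gt_atTop 0] with t ht
    rw [id, le_div_iff₀ ht, mul_comm]
    exact hK t ht.le
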